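/- Let $p\ge 1$, $\alpha>0$, $\beta>0$. There is a constant $C=C_{p,\alpha,\beta}>0$, depending only on $p,\alpha,\beta$ (hence only on $\alpha,\beta$ when $\alpha=2p$), such that the following holds. Let $(E,d)$ be a Polish space, let $\mu$ be a Borel probability measure on $E$, let $n\ge 1$, let $X_1,\dots,X_n$ be independent $E$-valued random variables with common distribution $\mu$, defined on a probability space $(\Omega,\mathcal A,\mathbb P)$, and let $L_n=\frac1n\sum_{i=1}^n\delta_{X_i}$ be their empirical measure. Let $S\subset E$ be a bounded set with $\mu(S)=1$ and diameter $\Delta$, of finite-dimensional type in the sense that $$N(S,\delta)\le \beta\left(\frac{\Delta}{\delta}\right)^{\alpha}\qquad\text{for all }\delta\in(0,\Delta],$$ where $N(S,\delta)$ is the minimal number of closed balls of radius $\delta$, with centres in $S$, needed to cover $S$. Let $$W_p^p(\mu,\nu)=\inf_{\pi}\int d(y,z)^p\,\pi(dy,dz),$$ the infimum being over all probability measures $\pi$ on $E\times E$ with marginals $\mu$ and $\nu$. Then, for every $x>0$, $$\mathbb P\left(W_p^p(\mu,L_n)>x\right)\le e^2\,\mathbf 1_{x\le\Delta^p}\times\begin{cases}\exp\left(-n\left[\dfrac{x}{C\Delta^p}\right]^2\right)&\text{if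 }\alpha<2p,\\[2ex]\exp\left(-n\left[\dfrac{x}{C\Delta^p\log\left(e+\frac{C\Delta^p}{x}\right)}\right]^2\right)&\text{if }\alpha=2p,\\[2ex]\exp\left(-n\left[\dfrac{x}{C\Delta^p}\right]^{\alpha/p}\right)&\text{if }\alpha>2p,\end{cases}$$ where the right-hand side is read as $0$ if $x>\Delta^p$ (in particular if $\Delta=0$). -/

import Mathlib

open MeasureTheory ProbabilityTheory
open scoped NNReal ENNReal

/-- The couplings of `μ` and `ν`: measures on `E × E` with first marginal `μ` and second
marginal `ν` (probability measures as soon as `μ` is one). -/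
def couplings {E : Type*} [MeasurableSpace E] (μ ν : Measure E) : Set (Measure (E × E)) :=
  {π | π.map Prod.fst = μ ∧ π.map Prod.snd = ν}

/-- The `p`-th power `W_p^p (μ, ν)` of the Wasserstein distance of order `p`: the infimum over all
couplings `π` of `∫ d(x, y)^p π(dx, dy)`, as an element of `[0, ∞]`. -/
noncomputable def wassersteinPow {E : Type*} [MetricSpace E] [MeasurableSpace E]
    (p : ℝ) (μ ν : Measure E) : ℝ≥0∞ :=
  ⨅ π ∈ couplings μ ν, ∫⁻ z, edist z.1 z.2 ^ p ∂π

/-- The empirical measure `L_n = (1 / n) ∑ i, δ_{x_i}` of a sample `x_1, …, x_n`. -/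
noncomputable def empiricalMeasure {E : Type*} [MeasurableSpace E] {n : ℕ} (x : Fin n → E) :
    Measure E :=
  (n : ℝ≥0∞)⁻¹ • ∑ i, Measure.dirac (x i)

/-- A bounded set `S` of diameter `Δ` is of finite-dimensional type with parameters `α`, `β` if
`N(S, δ) ≤ β (Δ / δ)^α` for all `δ ∈ (0, Δ]`. Here `N(S, δ)` is the minimal number of closed balls
of radius `δ` with centres in `S` that cover `S` (infinite if there is no finite cover). -/
def IsFiniteDimensionalType {E : Type*} [MetricSpace E] (S : Set E) (α β : ℝ) : Prop :=
  Bornology.IsBounded S ∧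
    ∀ δ : ℝ≥0, 0 < δ → (δ : ℝ) ≤ Metric.diam S →
      (Metric.coveringNumber δ S : ℝ≥0∞) ≤ ENNReal.ofReal (β * (Metric.diam S / δ) ^ α)

/-! Cover `S` at the scales `Δ / 2 ^ k` and turn the covers into nested partitions. Transport
greedily: couple as much mass as possible inside the finest cells, then the remainder inside coarser
cells, and so on. The mass left after level `k + 1` is the cell excess there, and each unit of it is
charged `D k`, of order `(Δ / 2 ^ k) ^ p`. So `W_p^p` is at most the finest cost plus a weighted sum
of excesses (`exists_coupling_lintegral_le`).

The excess over `N` cells is the deviation of `μ` from `L_n` on one of `2 ^ N` unions of cells, so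
Hoeffding and a union bound control it (`measureReal_lt_cellExcess_le`). As `N` is at most of order
`2 ^ (α k)`, thresholds proportional to `v * 2 ^ (α k / 2)` make the tails sum to at most `exp (-n v
^ 2)` (`two_pow_mul_exp_le`).

Weighted by the costs, these thresholds add up to `v` times a geometric series of ratio `2 ^ (α / 2
- p)`. It converges, has constant terms, or is dominated by its last term, according to the sign of
`α - 2 p`; choosing `v` so that the total fits in `z = x / Δ ^ p` gives the three rates
(`exists_scale_sum_le`). The factor `e ^ 2` makes the bound trivial when `n v ^ 2 < 2`. -/

/-- The mass by which `μ` exceeds `ν`, summed over the cells `g ⁻¹' {a}`, `a ∈ s`. -/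
noncomputable def cellExcess {E ι : Type*} [MeasurableSpace E] (s : Finset ι) (g : E → ι)
    (μ ν : Measure E) : ℝ≥0∞ :=
  ∑ a ∈ s, (μ (g ⁻¹' {a}) - ν (g ⁻¹' {a}))

/-! ### Greedy couplings along nested partitions. -/

lemma ENNReal.one_sub_inv_max_mul_mul {a b : ℝ≥0∞} (ha : a ≠ ⊤) (hb : b ≠ ⊤) :
    (1 - (max a b)⁻¹ * b) * a = a - b := by
  rcases eq_or_ne a 0 with rfl | ha0
  · simp
  rcases le_total a b with h | h
  · have hb0 : b ≠ 0 := fun h0 => ha0 (le_antisymm (h0 ▸ h) zero_le)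
    rw [max_eq_right h, ENNReal.inv_mul_cancel hb0 hb, tsub_self, zero_mul,
      tsub_eq_zero_of_le h]
  · rw [max_eq_left h, ENNReal.sub_mul (fun _ _ => ha), one_mul, mul_right_comm,
      ENNReal.inv_mul_cancel ha0 ha, one_mul]

lemma ENNReal.inv_max_mul_le_one (a b : ℝ≥0∞) : (max a b)⁻¹ * b ≤ 1 :=
  (mul_le_mul_right (le_max_right a b) _).trans (ENNReal.inv_mul_le_one _)

section

variable {E ι : Type*} [MeasurableSpace E]

/-- Two finite measures can be coupled up to the difference of their masses. -/
lemma exists_partial_coupling (μ ν : Measure E) [IsFiniteMeasure μ] [IsFiniteMeasure ν] :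
    ∃ (π : Measure (E × E)) (μ' ν' : Measure E), μ = π.map Prod.fst + μ' ∧
      ν = π.map Prod.snd + ν' ∧ μ' Set.univ = μ Set.univ - ν Set.univ ∧
      ν' Set.univ = ν Set.univ - μ Set.univ := by
  set M := max (μ Set.univ) (ν Set.univ) with hM
  -- Dividing the product by the larger mass keeps the marginals below `μ` and `ν` and exhausts the
  -- lighter measure.
  refine ⟨M⁻¹ • μ.prod ν, (1 - M⁻¹ * ν Set.univ) • μ, (1 - M⁻¹ * μ Set.univ) • ν, ?_, ?_, ?_, ?_⟩
  · rw [Measure.map_smul, Measure.map_fst_prod, smul_smul, ← add_smul, add_tsub_cancel_of_le,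
      one_smul]
    exact ENNReal.inv_max_mul_le_one _ _
  · rw [Measure.map_smul, Measure.map_snd_prod, smul_smul, ← add_smul, add_tsub_cancel_of_le,
      one_smul]
    rw [hM, max_comm]
    exact ENNReal.inv_max_mul_le_one _ _
  · rw [Measure.smul_apply, smul_eq_mul, ENNReal.one_sub_inv_max_mul_mul (measure_ne_top _ _)
      (measure_ne_top _ _)]
  · rw [Measure.smul_apply, smul_eq_mul, hM, max_comm,
      ENNReal.one_sub_inv_max_mul_mul (measure_ne_top _ _)
      (measure_ne_top _ _)]

lemma sum_restrict_preimage_singleton [MeasurableSpace ι] [MeasurableSingletonClass ι]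
    {s : Finset ι} {g : E → ι} (hg : Measurable g) (hgs : ∀ x, g x ∈ s) (μ : Measure E) :
    ∑ a ∈ s, μ.restrict (g ⁻¹' {a}) = μ := by
  ext A hA
  rw [Measure.finsetSum_apply]
  simp_rw [Measure.restrict_apply hA]
  rw [← measure_biUnion_finset]
  · congr 1
    ext x
    simp [hgs]
  · intro a _ b _ hab
    refine Set.disjoint_left.2 fun x hx hy => hab ?_
    exact hx.2.symm.trans hy.2
  · exact fun a _ => hA.inter (hg (measurableSet_singleton a))

lemma ae_eq_cell_of_map_le [MeasurableSpace ι] [MeasurableSingletonClass ι]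
    {g : E → ι} (hg : Measurable g) {a : ι} {μ : Measure E}
    {π : Measure (E × E)} {q : E × E → E} (hq : Measurable q)
    (h : π.map q ≤ μ.restrict (g ⁻¹' {a})) : ∀ᵐ z ∂π, g (q z) = a := by
  have h1 : ∀ᵐ x ∂μ.restrict (g ⁻¹' {a}), g x = a :=
    ae_restrict_mem (hg (measurableSet_singleton a))
  exact ae_of_ae_map hq.aemeasurable (Measure.absolutelyContinuous_of_le h |>.ae_le h1)

/-- Two finite measures can be coupled inside the cells of a finite partition, up to their
differences of mass on the cells. -/
lemma exists_partial_coupling_cells [MeasurableSpace ι] [MeasurableSingletonClass ι]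
    {s : Finset ι} {g : E → ι} (hg : Measurable g) (hgs : ∀ x, g x ∈ s)
    (μ ν : Measure E) [IsFiniteMeasure μ] [IsFiniteMeasure ν] :
    ∃ (π : Measure (E × E)) (μ' ν' : Measure E), μ = π.map Prod.fst + μ' ∧
      ν = π.map Prod.snd + ν' ∧ (∀ᵐ z ∂π, g z.1 = g z.2) ∧
      μ' Set.univ = cellExcess s g μ ν := by
  choose π μ' ν' h1 h2 h3 _ using fun a => exists_partial_coupling (μ.restrict (g ⁻¹' {a}))
    (ν.restrict (g ⁻¹' {a}))
  have hm : ∀ q : E × E → E, Measurable q →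
      (∑ a ∈ s, π a).map q = ∑ a ∈ s, (π a).map q := by
    intro q hq
    ext A hA
    simp [Measure.map_apply hq hA, Measure.finsetSum_apply]
  refine ⟨∑ a ∈ s, π a, ∑ a ∈ s, μ' a, ∑ a ∈ s, ν' a, ?_, ?_, ?_, ?_⟩
  · rw [hm _ measurable_fst, ← Finset.sum_add_distrib]
    conv_lhs => rw [← sum_restrict_preimage_singleton hg hgs μ]
    exact Finset.sum_congr rfl fun a _ => h1 a
  · rw [hm _ measurable_snd, ← Finset.sum_add_distrib]
    conv_lhs => rw [← sum_restrict_preimage_singleton hg hgs ν]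
    exact Finset.sum_congr rfl fun a _ => h2 a
  · rw [ae_iff, Measure.finsetSum_apply]
    refine Finset.sum_eq_zero fun a _ => ?_
    rw [← ae_iff]
    have e1 := ae_eq_cell_of_map_le hg (π := π a) (q := Prod.fst) measurable_fst
      ((Measure.le_add_right le_rfl).trans (h1 a).ge)
    have e2 := ae_eq_cell_of_map_le hg (π := π a) (q := Prod.snd) measurable_snd
      ((Measure.le_add_right le_rfl).trans (h2 a).ge)
    filter_upwards [e1, e2] with z hz1 hz2
    rw [hz1, hz2]
  · rw [Measure.finsetSum_apply, cellExcess]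
    exact Finset.sum_congr rfl fun a _ => by simpa using h3 a

/-- A coupling that never leaves a cell removes equal mass from both measures on every union of
cells, so the excesses of coarser partitions survive its removal. -/
lemma map_fst_apply_preimage_eq_map_snd [MeasurableSpace ι] {g : E → ι} (hg : Measurable g)
    {π : Measure (E × E)} (h : ∀ᵐ z ∂π, g z.1 = g z.2) {A : Set ι} (hA : MeasurableSet A) :
    π.map Prod.fst (g ⁻¹' A) = π.map Prod.snd (g ⁻¹' A) := by
  rw [Measure.map_apply measurable_fst (hg hA), Measure.map_apply measurable_snd (hg hA)]
  refine measure_congr (Filter.eventuallyEq_set.2 ?_)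
  filter_upwards [h] with z hz
  simp only [Set.mem_preimage, hz]

/-- The greedy multiscale coupling: match mass in the finest cells first, then the remainder in
coarser and coarser cells. -/
theorem exists_coupling_lintegral_le [MeasurableSpace ι] [MeasurableSingletonClass ι]
    (c : E × E → ℝ≥0∞) (D : ℕ → ℝ≥0∞)
    (s : ℕ → Finset ι) (g : ℕ → E → ι) (hc : ∀ z, c z ≤ D 0) (K : ℕ)
    (hg : ∀ k ≤ K, Measurable (g k)) (hgs : ∀ k ≤ K, ∀ x, g k x ∈ s k)
    (hcD : ∀ k ≤ K, ∀ x y, g k x = g k y → c (x, y) ≤ D k)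
    (hnest : ∀ k ≤ K, ∀ j ≤ k, ∀ x y, g k x = g k y → g j x = g j y)
    (μ ν : Measure E) [IsFiniteMeasure μ] [IsFiniteMeasure ν] (h : μ Set.univ = ν Set.univ) :
    ∃ π ∈ couplings μ ν, ∫⁻ z, c z ∂π ≤ D K * μ Set.univ +
      ∑ k ∈ Finset.range K, D k * cellExcess (s (k + 1)) (g (k + 1)) μ ν := by
  induction K generalizing μ ν with
  -- Every cost is at most `D 0`, so any full coupling will do and no partition is used at level
  -- `0`.
  | zero =>
    obtain ⟨π, μ', ν', h1, h2, h3, h4⟩ := exists_partial_coupling μ ν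
    rw [h, tsub_self, Measure.measure_univ_eq_zero] at h3
    rw [h, tsub_self, Measure.measure_univ_eq_zero] at h4
    rw [h3, add_zero] at h1
    rw [h4, add_zero] at h2
    refine ⟨π, ⟨h1.symm, h2.symm⟩, ?_⟩
    have : π Set.univ = μ Set.univ := by
      rw [h1, Measure.map_apply measurable_fst MeasurableSet.univ, Set.preimage_univ]
    simpa [this] using lintegral_mono (μ := π) hc
  | succ K ih =>
    obtain ⟨π, μ', ν', h1, h2, h3, h4⟩ :=
      exists_partial_coupling_cells (hg (K + 1) le_rfl) (hgs (K + 1) le_rfl) μ ν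
    have hμ' : μ' ≤ μ := by
      conv_rhs => rw [h1]
      exact Measure.le_add_left le_rfl
    have hν' : ν' ≤ ν := by
      conv_rhs => rw [h2]
      exact Measure.le_add_left le_rfl
    have hπ : π.map Prod.fst ≤ μ := by
      conv_rhs => rw [h1]
      exact Measure.le_add_right le_rfl
    have hfst : ∀ A, π.map Prod.fst A ≠ ⊤ := fun A =>
      ne_top_of_le_ne_top (measure_ne_top μ A) (hπ A)
    have hμf : IsFiniteMeasure μ' := isFiniteMeasure_of_le μ hμ'
    have hνf : IsFiniteMeasure ν' := isFiniteMeasure_of_le ν hν'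
    have huniv : π.map Prod.fst Set.univ = π.map Prod.snd Set.univ := by
      rw [Measure.map_apply measurable_fst MeasurableSet.univ,
        Measure.map_apply measurable_snd MeasurableSet.univ]
      rfl
    have hmass : μ' Set.univ = ν' Set.univ := by
      have := h
      rw [h1, h2, Measure.add_apply, Measure.add_apply, huniv] at this
      exact (ENNReal.add_right_inj (huniv ▸ hfst _)).1 this
    obtain ⟨π', ⟨h5, h6⟩, h7⟩ := ih (fun k hk => hg k (by omega)) (fun k hk => hgs k (by omega))
      (fun k hk => hcD k (by omega)) (fun k hk => hnest k (by omega)) μ' ν' hmass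
    refine ⟨π + π', ⟨?_, ?_⟩, ?_⟩
    · rw [Measure.map_add _ _ measurable_fst, h5, ← h1]
    · rw [Measure.map_add _ _ measurable_snd, h6, ← h2]
    -- By nesting, the finest coupling also preserves the coarser cells: its two marginals cancel in
    -- each difference, and the remainders have the excesses of `μ` and `ν`.
    have hex : ∀ k ∈ Finset.range K, D k * cellExcess (s (k + 1)) (g (k + 1)) μ' ν' =
        D k * cellExcess (s (k + 1)) (g (k + 1)) μ ν := by
      intro k hk
      rw [Finset.mem_range] at hk
      congr 1
      refine Finset.sum_congr rfl fun a _ => ?_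
      have hmeas : Measurable (g (k + 1)) := hg _ (by omega)
      have hkk : ∀ᵐ z ∂π, g (k + 1) z.1 = g (k + 1) z.2 := by
        filter_upwards [h3] with z hz
        exact hnest (K + 1) le_rfl (k + 1) (by omega) _ _ hz
      have e := map_fst_apply_preimage_eq_map_snd hmeas hkk (measurableSet_singleton a)
      have := hfst (g (k + 1) ⁻¹' {a})
      conv_rhs => rw [h1, h2, Measure.add_apply, Measure.add_apply, ← e]
      rw [ENNReal.add_sub_add_eq_sub_left this]
    have hcost : ∫⁻ z, c z ∂π ≤ D (K + 1) * μ Set.univ := by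
      calc ∫⁻ z, c z ∂π ≤ ∫⁻ _, D (K + 1) ∂π := by
            refine lintegral_mono_ae ?_
            filter_upwards [h3] with z hz
            exact hcD (K + 1) le_rfl z.1 z.2 hz
        _ = D (K + 1) * π.map Prod.fst Set.univ := by
            rw [lintegral_const, Measure.map_apply measurable_fst MeasurableSet.univ,
              Set.preimage_univ]
        _ ≤ _ := by gcongr
    -- The induction hypothesis charges `D K` to the whole remainder, whose mass is the excess at
    -- level `K + 1`; hence the shift of index.
    rw [lintegral_add_measure, Finset.sum_range_succ, ← h4]
    rw [Finset.sum_congr rfl hex] at h7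
    calc _ ≤ D (K + 1) * μ Set.univ + (D K * μ' Set.univ +
          ∑ k ∈ Finset.range K, D k * cellExcess (s (k + 1)) (g (k + 1)) μ ν) :=
        add_le_add hcost h7
      _ = _ := by rw [add_comm (D K * _)]

end

/-! ### Deviations of the empirical measure on cells. -/

section

variable {E ι Ω : Type*} [MeasurableSpace E] [MeasurableSpace Ω]

lemma isProbabilityMeasure_empiricalMeasure {n : ℕ} (hn : 0 < n) (x : Fin n → E) :
    IsProbabilityMeasure (empiricalMeasure x) := by
  constructor
  simp only [empiricalMeasure, Measure.smul_apply, Measure.finsetSum_apply, measure_univ,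
    Finset.sum_const, Finset.card_univ, Fintype.card_fin, nsmul_eq_mul, mul_one, smul_eq_mul]
  exact ENNReal.inv_mul_cancel (by simpa using hn.ne') (ENNReal.natCast_ne_top n)

lemma empiricalMeasure_real_apply {n : ℕ} (x : Fin n → E) {B : Set E} (hB : MeasurableSet B) :
    (empiricalMeasure x).real B = (n : ℝ)⁻¹ * ∑ i, B.indicator 1 (x i) := by
  simp only [empiricalMeasure, Measure.real, Measure.smul_apply, Measure.finsetSum_apply,
    smul_eq_mul, ENNReal.toReal_mul, ENNReal.toReal_inv, ENNReal.toReal_natCast]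
  rw [ENNReal.toReal_sum (fun i _ => measure_ne_top _ _)]
  congr 1
  refine Finset.sum_congr rfl fun i _ => ?_
  rw [Measure.dirac_apply' _ hB]
  by_cases h : x i ∈ B <;> simp [h]

/-- Hoeffding's inequality for the empirical measure of a set. -/
lemma measureReal_empiricalMeasure_deviation_le {P : Measure Ω} [IsProbabilityMeasure P]
    {μ : Measure E} {n : ℕ} {X : Fin n → Ω → E}
    (hn : 0 < n) (hX : ∀ i, Measurable (X i)) (hind : iIndepFun X P) (hlaw : ∀ i, P.map (X i) = μ)
    {B : Set E} (hB : MeasurableSet B) {y : ℝ} (hy : 0 ≤ y) :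
    P.real {ω | y ≤ μ.real B - (empiricalMeasure fun i => X i ω).real B} ≤
      Real.exp (-(2 * n * y ^ 2)) := by
  have hn' : (0 : ℝ) < n := by exact_mod_cast hn
  -- The sign turns the lower deviation of the empirical mass into an upper tail; values in `[-1,
  -- 0]` give the sub-Gaussian parameter `1 / 4`.
  set f : E → ℝ := fun e => -B.indicator 1 e with hf
  have hfm : Measurable f := (measurable_one.indicator hB).neg
  have hint : ∀ i, P[fun ω => f (X i ω)] = -μ.real B := by
    intro i
    rw [← hlaw i, ← integral_map (f := f) (hX i).aemeasurable hfm.aestronglyMeasurable, hf,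
      integral_neg, integral_indicator_one hB]
  have hsub : ∀ i ∈ Finset.univ, HasSubgaussianMGF (fun ω => f (X i ω) + μ.real B)
      ((‖(0 : ℝ) - (-1)‖₊ / 2) ^ 2) P := by
    intro i _
    have := hasSubgaussianMGF_of_mem_Icc (μ := P) (X := fun ω => f (X i ω)) (a := -1) (b := 0)
      (hfm.comp (hX i)).aemeasurable (Filter.Eventually.of_forall fun ω => by
        by_cases h : X i ω ∈ B <;> simp [hf, h])
    rw [hint i] at this
    simpa using this
  have hind' : iIndepFun (fun i ω => f (X i ω) + μ.real B) P :=
    hind.comp (fun _ e => f e + μ.real B) (fun _ => hfm.add_const _)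
  have key := HasSubgaussianMGF.measure_sum_ge_le_of_iIndepFun hind' hsub
    (ε := n * y) (by positivity)
  refine (measureReal_mono ?_).trans (key.trans (le_of_eq ?_))
  · intro ω hω
    simp only [Set.mem_ofPred_eq, empiricalMeasure_real_apply _ hB] at hω ⊢
    have : ∑ i : Fin n, (f (X i ω) + μ.real B) =
        n * (μ.real B - (n : ℝ)⁻¹ * ∑ i, B.indicator 1 (X i ω)) := by
      rw [Finset.sum_add_distrib, Finset.sum_const, Finset.card_univ, Fintype.card_fin, hf,
        Finset.sum_neg_distrib, mul_sub, mul_inv_cancel_left₀ hn'.ne', nsmul_eq_mul]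
      ring
    rw [this]
    exact mul_le_mul_of_nonneg_left hω hn'.le
  · congr 1
    simp only [Finset.sum_const, Finset.card_univ, Fintype.card_fin]
    have : ((n • (‖(0 : ℝ) - (-1)‖₊ / 2) ^ 2 : ℝ≥0) : ℝ) = n / 4 := by
      push_cast
      norm_num [nsmul_eq_mul]
      ring
    rw [this]
    field_simp
    ring

/-- Take for `U` the cells where `μ` dominates `ν`: the others contribute nothing to the truncated
sum. The excess becomes a deviation on a single set, ready for Hoeffding. -/
lemma cellExcess_le_ofReal [MeasurableSpace ι] [MeasurableSingletonClass ι] (s : Finset ι)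
    {g : E → ι} (hg : Measurable g) (μ ν : Measure E) [IsFiniteMeasure μ] [IsFiniteMeasure ν] :
    ∃ U ⊆ s, cellExcess s g μ ν ≤
      ENNReal.ofReal (μ.real (g ⁻¹' (U : Set ι)) - ν.real (g ⁻¹' (U : Set ι))) := by
  classical
  refine ⟨s.filter fun a => ν (g ⁻¹' {a}) ≤ μ (g ⁻¹' {a}), Finset.filter_subset _ _, ?_⟩
  set U := s.filter fun a => ν (g ⁻¹' {a}) ≤ μ (g ⁻¹' {a}) with hU
  have hsum : ∀ ρ : Measure E, IsFiniteMeasure ρ →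
      ρ.real (g ⁻¹' (U : Set ι)) = ∑ a ∈ U, ρ.real (g ⁻¹' {a}) := by
    intro ρ _
    rw [Measure.real, ← sum_measure_preimage_singleton U
      (fun a _ => hg (measurableSet_singleton a)), ENNReal.toReal_sum fun a _ => measure_ne_top _ _]
    rfl
  rw [hsum μ ‹_›, hsum ν ‹_›, ← Finset.sum_sub_distrib, cellExcess,
    ENNReal.ofReal_sum_of_nonneg]
  · rw [← Finset.sum_filter_add_sum_filter_not s fun a => ν (g ⁻¹' {a}) ≤ μ (g ⁻¹' {a})]
    rw [Finset.sum_eq_zero (s := s.filter fun a => ¬ _), add_zero]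
    · refine Finset.sum_le_sum fun a _ => ?_
      rw [ENNReal.ofReal_sub _ measureReal_nonneg, ofReal_measureReal, ofReal_measureReal]
    · intro a ha
      exact tsub_eq_zero_of_le (not_le.1 (Finset.mem_filter.1 ha).2).le
  · intro a ha
    exact sub_nonneg.2 (ENNReal.toReal_mono (measure_ne_top _ _) (Finset.mem_filter.1 ha).2)

/-- A one-sided form of the Bretagnolle–Huber–Carol inequality. -/
lemma measureReal_lt_cellExcess_le [MeasurableSpace ι] [MeasurableSingletonClass ι]
    {P : Measure Ω} [IsProbabilityMeasure P]
    {μ : Measure E} [IsFiniteMeasure μ] {n : ℕ} {X : Fin n → Ω → E}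
    (hn : 0 < n) (hX : ∀ i, Measurable (X i)) (hind : iIndepFun X P) (hlaw : ∀ i, P.map (X i) = μ)
    (s : Finset ι) {g : E → ι} (hg : Measurable g) {y : ℝ} (hy : 0 ≤ y) :
    P.real {ω | ENNReal.ofReal y < cellExcess s g μ (empiricalMeasure fun i => X i ω)} ≤
      2 ^ s.card * Real.exp (-(2 * n * y ^ 2)) := by
  have hsub : {ω | ENNReal.ofReal y < cellExcess s g μ (empiricalMeasure fun i => X i ω)} ⊆
      ⋃ U ∈ s.powerset, {ω | y ≤ μ.real (g ⁻¹' (U : Set ι)) -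
        (empiricalMeasure fun i => X i ω).real (g ⁻¹' (U : Set ι))} := by
    intro ω hω
    have := isProbabilityMeasure_empiricalMeasure hn fun i => X i ω
    obtain ⟨U, hUs, hU⟩ := cellExcess_le_ofReal s hg μ (empiricalMeasure fun i => X i ω)
    refine Set.mem_biUnion (Finset.mem_powerset.2 hUs) ?_
    exact ((ENNReal.ofReal_lt_ofReal_iff_of_nonneg hy).1 (lt_of_lt_of_le hω hU)).le
  refine (measureReal_mono hsub (measure_ne_top _ _)).trans ((measureReal_biUnion_finset_le _ _).trans ?_)
  refine (Finset.sum_le_sum fun U _ => measureReal_empiricalMeasure_deviation_le hn hX hind hlaw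
    (hg U.measurableSet) hy).trans ?_
  simp

end

/-! ### Transport cost and nested partitions of a set of finite-dimensional type. -/

/-- The multiscale upper bound of the Wasserstein cost through the discrepancies on nested cells. -/
lemma wassersteinPow_le_of_cells {E ι : Type*} [MetricSpace E] [MeasurableSpace E]
    [MeasurableSpace ι] [MeasurableSingletonClass ι]
    {p : ℝ} {T : Set E} (D : ℕ → ℝ≥0∞)
    (s : ℕ → Finset ι) (g : ℕ → E → ι) (hD : ∀ x ∈ T, ∀ y ∈ T, edist x y ^ p ≤ D 0) (K : ℕ)
    (hg : ∀ k ≤ K, Measurable (g k)) (hgs : ∀ k ≤ K, ∀ x, g k x ∈ s k)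
    (hgD : ∀ k ≤ K, ∀ x ∈ T, ∀ y ∈ T, g k x = g k y → edist x y ^ p ≤ D k)
    (hnest : ∀ k ≤ K, ∀ j ≤ k, ∀ x y, g k x = g k y → g j x = g j y)
    (μ ν : Measure E) [IsProbabilityMeasure μ] [IsProbabilityMeasure ν]
    (hμ : μ Tᶜ = 0) (hν : ν Tᶜ = 0) :
    wassersteinPow p μ ν ≤ D K +
      ∑ k ∈ Finset.range K, D k * cellExcess (s (k + 1)) (g (k + 1)) μ ν := by
  -- The cost is controlled only on `T`, so it is cut off outside `T ×ˢ T`; couplings of `μ` and `ν`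
  -- do not charge that region.
  have hind : ∀ (F : ℝ≥0∞) (x y : E), (x ∈ T → y ∈ T → edist x y ^ p ≤ F) →
      (T ×ˢ T).indicator (fun z : E × E => edist z.1 z.2 ^ p) (x, y) ≤ F := by
    intro F x y h
    by_cases hxy : (x, y) ∈ T ×ˢ T
    · rw [Set.indicator_of_mem hxy]
      exact h hxy.1 hxy.2
    · rw [Set.indicator_of_notMem hxy]
      exact zero_le
  obtain ⟨π, hπ, hle⟩ := exists_coupling_lintegral_le
    ((T ×ˢ T).indicator fun z : E × E => edist z.1 z.2 ^ p) D s g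
    (fun z => hind _ z.1 z.2 fun h1 h2 => hD _ h1 _ h2) K hg hgs
    (fun k hk x y hxy => hind _ x y fun h1 h2 => hgD k hk x h1 y h2 hxy) hnest μ ν (by simp)
  rw [measure_univ, mul_one] at hle
  refine (iInf₂_le π hπ).trans (le_trans (le_of_eq (lintegral_congr_ae ?_)) hle)
  have h1 : ∀ᵐ z ∂π, z.1 ∈ T :=
    ae_of_ae_map measurable_fst.aemeasurable (by rw [hπ.1]; exact hμ)
  have h2 : ∀ᵐ z ∂π, z.2 ∈ T :=
    ae_of_ae_map measurable_snd.aemeasurable (by rw [hπ.2]; exact hν)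
  filter_upwards [h1, h2] with z hz1 hz2
  rw [Set.indicator_of_mem (Set.mk_mem_prod hz1 hz2)]

/-- A measurable selection of a centre of a finite cover. -/
lemma exists_measurable_center {E : Type*} [MetricSpace E] [MeasurableSpace E] [BorelSpace E]
    {S : Set E} (hS : S.Nonempty) {δ : ℝ≥0} {N : ℝ}
    (h : (Metric.coveringNumber δ S : ℝ≥0∞) ≤ ENNReal.ofReal N) :
    ∃ (f : E → E) (s : Finset E), Measurable f ∧ (∀ x, f x ∈ s) ∧ (s : Set E) ⊆ S ∧
      (s.card : ℝ) ≤ N ∧ ∀ x ∈ closure S, dist x (f x) ≤ δ := by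
  have htop : Metric.coveringNumber δ S ≠ ⊤ := by
    intro h0
    rw [h0] at h
    exact absurd h (by simp)
  obtain ⟨C, hCS, hCfin, hcov, hcard⟩ := Metric.exists_set_encard_eq_coveringNumber htop
  lift C to Finset E using hCfin
  obtain ⟨c₀, hc₀⟩ : C.Nonempty := by simpa using hcov.nonempty hS
  have hNpos : (C.card : ℝ) ≤ N := by
    rw [← hcard, Set.encard_coe_eq_coe_finsetCard] at h
    have h' : ENNReal.ofReal (C.card : ℝ) ≤ ENNReal.ofReal N := by simpa using h
    have hc : (0 : ℝ) < C.card := by exact_mod_cast Finset.card_pos.2 ⟨c₀, hc₀⟩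
    by_contra! hlt
    exact absurd h' (not_le.2 ((ENNReal.ofReal_lt_ofReal_iff hc).2 hlt))
  -- `nearestPt e C.card` also consults index `C.card`, where the default `c₀` keeps the value
  -- inside `C`.
  let e : ℕ → E := fun i => if hi : i < C.card then (C.equivFin.symm ⟨i, hi⟩ : E) else c₀
  have heC : ∀ i, e i ∈ C := by
    intro i
    simp only [e]
    split_ifs
    · exact Finset.coe_mem _
    · exact hc₀
  refine ⟨SimpleFunc.nearestPt e C.card, C, SimpleFunc.measurable _, fun x => heC _, hCS, hNpos,
    fun x hx => ?_⟩
  -- A finite union of closed balls is closed, so a cover of `S` covers `closure S` with the same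
  -- radius.
  have hclosed : IsClosed (⋃ y ∈ (C : Set E), Metric.closedBall y (δ : ℝ)) :=
    C.finite_toSet.isClosed_biUnion fun _ _ => Metric.isClosed_closedBall
  have hx' := closure_minimal (Metric.isCover_iff_subset_iUnion_closedBall.1 hcov) hclosed hx
  obtain ⟨y, hy, hxy⟩ := Set.mem_iUnion₂.1 hx'
  have hyi : e (C.equivFin ⟨y, hy⟩) = y := by simp [e]
  have := SimpleFunc.edist_nearestPt_le e x (C.equivFin ⟨y, hy⟩).2.le
  rw [hyi, edist_dist, edist_dist, ENNReal.ofReal_le_ofReal_iff dist_nonneg] at this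
  rw [dist_comm]
  exact this.trans (by rw [dist_comm]; exact hxy)

/-- Nested measurable partitions of a set of finite-dimensional type at the scales
`2 ^ (-k) * diam S`, `k ≤ K`. -/
lemma exists_nested_cells {E : Type*} [MetricSpace E] [MeasurableSpace E] [BorelSpace E]
    {S : Set E} {α β : ℝ} (h : IsFiniteDimensionalType S α β) (hΔ : 0 < Metric.diam S) (K : ℕ) :
    ∃ (g : ℕ → E → E) (s : ℕ → Finset E), (∀ k, ((s k).card : ℝ) ≤ β * ((2 : ℝ) ^ α) ^ k) ∧
      (∀ k ≤ K, Measurable (g k)) ∧ (∀ k ≤ K, ∀ x, g k x ∈ s k) ∧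
      (∀ k ≤ K, ∀ x ∈ closure S, dist x (g k x) ≤ 2 * (Metric.diam S / 2 ^ k)) ∧
      (∀ k ≤ K, ∀ j ≤ k, ∀ x y, g k x = g k y → g j x = g j y) := by
  have hS : S.Nonempty := by
    by_contra h0
    rw [Set.not_nonempty_iff_eq_empty] at h0
    simp [h0] at hΔ
  have hδ : ∀ k : ℕ, (0 : ℝ) < Metric.diam S / 2 ^ k := fun k => by positivity
  choose f s hf hfs hsS hcard hdist using fun k : ℕ =>
    exists_measurable_center hS (h.2 (.mk (Metric.diam S / 2 ^ k) (hδ k).le) (hδ k)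
      (div_le_self hΔ.le (one_le_pow₀ one_le_two)))
  -- `G m` lives at scale `K - m`. Starting from the finest centres and composing with coarser
  -- selections makes nesting automatic; the errors add up geometrically, to at most twice the
  -- current radius.
  let G : ℕ → E → E := fun m => Nat.rec (f K) (fun m G => f (K - (m + 1)) ∘ G) m
  have hG : ∀ m ≤ K, Measurable (G m) ∧ (∀ x, G m x ∈ s (K - m)) ∧
      ∀ x ∈ closure S, dist x (G m x) ≤ 2 * (Metric.diam S / 2 ^ (K - m)) := by
    intro m
    induction m with
    | zero =>
      refine fun _ => ⟨hf K, hfs K, fun x hx => (hdist K x hx).trans ?_⟩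
      have := hδ K
      simp only [NNReal.coe_mk, Nat.sub_zero]
      linarith
    | succ m ih =>
      intro hm
      obtain ⟨h1, h2, h3⟩ := ih (by omega)
      refine ⟨(hf _).comp h1, fun x => hfs _ _, fun x hx => ?_⟩
      have e1 := h3 x hx
      have e2 := hdist (K - (m + 1)) (G m x) (subset_closure (hsS _ (h2 x)))
      have e3 := dist_triangle x (G m x) (f (K - (m + 1)) (G m x))
      have e4 : (2 : ℝ) ^ (K - m) = 2 * 2 ^ (K - (m + 1)) := by
        rw [← pow_succ']
        congr 1
        omega
      have e5 : 2 * (Metric.diam S / 2 ^ (K - m)) = Metric.diam S / 2 ^ (K - (m + 1)) := by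
        rw [e4]
        field_simp
      simp only [NNReal.coe_mk] at e2
      change dist x (f (K - (m + 1)) (G m x)) ≤ _
      linarith
  have hGn : ∀ m m', m ≤ m' → ∀ x y, G m x = G m y → G m' x = G m' y := by
    intro m m' hmm
    induction m', hmm using Nat.le_induction with
    | base => exact fun _ _ hxy => hxy
    | succ m' _ ih => exact fun x y hxy => congrArg (f (K - (m' + 1))) (ih x y hxy)
  have hKK : ∀ k ≤ K, K - (K - k) = k := fun k hk => by omega
  refine ⟨fun k => G (K - k), s, fun k => (hcard k).trans (le_of_eq ?_), fun k _ =>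
    (hG _ (Nat.sub_le _ _)).1, fun k hk x => ?_, fun k hk x hx => ?_, fun k hk j hj =>
    hGn _ _ (by omega)⟩
  · rw [NNReal.coe_mk, div_div_cancel₀ hΔ.ne', ← Real.rpow_natCast_mul two_pos.le,
      ← Real.rpow_mul_natCast two_pos.le, mul_comm α]
  · have := (hG (K - k) (Nat.sub_le _ _)).2.1 x
    rwa [hKK k hk] at this
  · have := (hG (K - k) (Nat.sub_le _ _)).2.2 x hx
    rwa [hKK k hk] at this

/-! ### Choice of scales, thresholds and constants. -/

/-- The exponent, per observation, of the concentration inequality. -/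
noncomputable def concentrationRate (p α C z : ℝ) : ℝ :=
  if α < 2 * p then (z / C) ^ 2
  else if α = 2 * p then (z / (C * Real.log (Real.exp 1 + C / z))) ^ 2
  else (z / C) ^ (α / p)

/-- The finest scale needed for the precision `z`. -/
lemma exists_nat_pow_scale {a A z : ℝ} (ha : 1 < a) (hA : 1 ≤ A) (hz : 0 < z) (hz1 : z ≤ 1) :
    ∃ K : ℕ, A / z ≤ a ^ K ∧ a ^ K ≤ a * (A / z) := by
  have h1 : 1 ≤ A / z := (one_le_div hz).2 (hz1.trans hA)
  obtain ⟨m, hm1, hm2⟩ := exists_nat_pow_near h1 ha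
  refine ⟨m + 1, hm2.le, ?_⟩
  rw [pow_succ']
  gcongr

/-- The truncated geometric series of the multiscale bound is of the order of the precision. -/
lemma exists_scale_sum_le {p α Q : ℝ} (hp : 1 ≤ p) (hα : 0 < α) (hQ : 0 < Q) :
    ∃ C : ℝ, 0 < C ∧ ∀ z : ℝ, 0 < z → z ≤ 1 → ∃ (K : ℕ) (v : ℝ), 0 ≤ v ∧
      v ^ 2 = concentrationRate p α C z ∧ (2 * 4 ^ p) / z ≤ ((2 : ℝ) ^ p) ^ K ∧
      Q * v * ∑ k ∈ Finset.range K, ((2 : ℝ) ^ (α / 2) / 2 ^ p) ^ k ≤ z := by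
  have hp0 : 0 < p := by linarith
  set A : ℝ := 2 * 4 ^ p with hA
  set a : ℝ := (2 : ℝ) ^ p with ha
  set r : ℝ := (2 : ℝ) ^ (α / 2) / a with hr
  have hA1 : 1 ≤ A := by
    have : (1 : ℝ) ≤ 4 ^ p := Real.one_le_rpow (by norm_num) hp0.le
    linarith
  have ha2 : 2 ≤ a := by
    calc (2 : ℝ) = 2 ^ (1 : ℝ) := (Real.rpow_one 2).symm
      _ ≤ a := Real.rpow_le_rpow_of_exponent_le one_le_two hp
  have hr0 : 0 < r := by positivity
  rcases lt_trichotomy α (2 * p) with h | h | h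
  -- Convergent series: the bound `1 / (1 - r)` is uniform in `K`.
  · have hr1 : r < 1 := (div_lt_one (by positivity)).2
      (Real.rpow_lt_rpow_of_exponent_lt one_lt_two (by linarith))
    have h1r : 0 < 1 - r := by linarith
    refine ⟨Q / (1 - r), by positivity, fun z hz hz1 => ?_⟩
    obtain ⟨K, hK, -⟩ := exists_nat_pow_scale (a := a) (by linarith) hA1 hz hz1
    refine ⟨K, z / (Q / (1 - r)), by positivity, by simp [concentrationRate, h], hK, ?_⟩
    have hsum : ∑ k ∈ Finset.range K, r ^ k ≤ 1 / (1 - r) := by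
      rw [le_div_iff₀ h1r, geom_sum_mul_neg]
      have : 0 ≤ r ^ K := by positivity
      linarith
    calc Q * (z / (Q / (1 - r))) * ∑ k ∈ Finset.range K, r ^ k
        ≤ Q * (z / (Q / (1 - r))) * (1 / (1 - r)) := by gcongr
      _ = z := by field_simp
  · have hr1 : r = 1 := by
      rw [hr, h, mul_div_cancel_left₀ p two_ne_zero, div_self (by positivity)]
    -- All `K` terms equal `1`. The summand `A` gives `log (A / z) ≤ L`, whence `K ≤ 1 + 2 * L ≤ 3 *
    -- L`; the summand `3 * Q` absorbs this factor.
    refine ⟨3 * Q + A, by positivity, fun z hz hz1 => ?_⟩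
    obtain ⟨K, hK, hK'⟩ := exists_nat_pow_scale (a := a) (by linarith) hA1 hz hz1
    set C := 3 * Q + A with hC
    set L := Real.log (Real.exp 1 + C / z) with hL
    have hC0 : 0 < C := by positivity
    have hL1 : 1 ≤ L := by
      rw [hL, Real.le_log_iff_exp_le (by positivity)]
      have : 0 ≤ C / z := by positivity
      linarith
    have hLA : Real.log (A / z) ≤ L := by
      refine Real.log_le_log (by positivity) ?_
      have : A / z ≤ C / z := by
        gcongr
        linarith
      linarith [Real.exp_pos 1]
    have hKL : (K : ℝ) ≤ 3 * L := by
      have e1 := Real.log_le_log (by positivity) hK'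
      rw [Real.log_pow, Real.log_mul (by positivity) (by positivity)] at e1
      have e2 : 1 / 2 ≤ Real.log a := by
        have := Real.log_le_log two_pos ha2
        linarith [Real.log_two_gt_d9]
      by_contra! hlt
      nlinarith
    refine ⟨K, z / (C * L), by positivity, by simp [concentrationRate, h, hL], hK, ?_⟩
    rw [hr1]
    simp only [one_pow, Finset.sum_const, Finset.card_range, nsmul_eq_mul, mul_one]
    calc Q * (z / (C * L)) * K ≤ Q * (z / (C * L)) * (3 * L) := by gcongr
      _ = z * (3 * Q / C) := by field_simp
      _ ≤ z * 1 := by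
        gcongr
        rw [div_le_one hC0]
        linarith
      _ = z := mul_one z
  -- The last term dominates: `r = a ^ (θ - 1)` and `a ^ K ≤ a * A / z` bound it by a multiple of `z
  -- ^ (1 - θ)`, which `v`, of order `z ^ θ`, brings back to order `z`.
  · set θ := α / (2 * p) with hθ
    have hθ1 : 1 < θ := (one_lt_div (by positivity)).2 h
    have hrθ : r = a ^ (θ - 1) := by
      rw [hr, Real.rpow_sub_one (by positivity), ha, ← Real.rpow_mul two_pos.le, hθ]
      congr 2
      field_simp
    have hr1 : 1 < r := by
      rw [hrθ]
      exact Real.one_lt_rpow (by linarith) (by linarith)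
    have h1r : 0 < r - 1 := by linarith
    set B := Q / (r - 1) * (a * A) ^ (θ - 1) with hB
    have hB0 : 0 < B := by positivity
    refine ⟨1 + B, by positivity, fun z hz hz1 => ?_⟩
    obtain ⟨K, hK, hK'⟩ := exists_nat_pow_scale (a := a) (by linarith) hA1 hz hz1
    refine ⟨K, (z / (1 + B)) ^ θ, by positivity, ?_, hK, ?_⟩
    · rw [concentrationRate, if_neg h.not_gt, if_neg h.ne', ← Real.rpow_mul_natCast (by positivity)]
      congr 1
      rw [hθ]
      push_cast
      field_simp
    have hsum : ∑ k ∈ Finset.range K, r ^ k ≤ r ^ K / (r - 1) := by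
      rw [le_div_iff₀ h1r, geom_sum_mul]
      linarith
    have hrK : r ^ K ≤ (a * A) ^ (θ - 1) / z ^ (θ - 1) := by
      rw [hrθ, ← Real.rpow_mul_natCast (by positivity), mul_comm,
        Real.rpow_natCast_mul (by positivity), ← Real.div_rpow (by positivity) hz.le]
      refine Real.rpow_le_rpow (by positivity) (hK'.trans (le_of_eq ?_)) (by linarith)
      ring
    -- Using `1 + B` rather than `B` makes the constant at least `1`, so its power `θ` may be
    -- replaced by itself.
    have hv : (z / (1 + B)) ^ θ ≤ z ^ θ / (1 + B) := by
      rw [Real.div_rpow hz.le (by positivity)]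
      gcongr
      exact Real.self_le_rpow_of_one_le (by linarith) hθ1.le
    calc Q * (z / (1 + B)) ^ θ * ∑ k ∈ Finset.range K, r ^ k
        ≤ Q * (z ^ θ / (1 + B)) * (((a * A) ^ (θ - 1) / z ^ (θ - 1)) / (r - 1)) := by
          gcongr
          exact hsum.trans (by gcongr)
      _ = z ^ θ / z ^ (θ - 1) * (B / (1 + B)) := by
          rw [hB]
          field_simp
      _ = z * (B / (1 + B)) := by
          rw [← Real.rpow_sub hz, sub_sub_cancel, Real.rpow_one]
      _ ≤ z * 1 := by
          gcongr
          rw [div_le_one (by positivity)]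
          linarith
      _ = z := mul_one z

/-- The exponential tails dominate the numbers of cells. -/
lemma two_pow_mul_exp_le {β h w : ℝ} {N k : ℕ} (hβ : 0 < β) (hh : 0 < h) (hw : 2 ≤ w)
    (hN : (N : ℝ) ≤ β * (1 + h) ^ k) :
    2 ^ N * Real.exp (-(2 * ((β / 4 + (1 + 1 / h) / 2) * w * (1 + h) ^ k))) ≤
      Real.exp (-w) * (1 / 2) ^ k := by
  set B := (1 + h) ^ k with hB
  -- Bernoulli's inequality lets the exponential `B` dominate `1 + k`, which supplies the factor `(1
  -- / 2) ^ k`.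
  have hBk : 1 + k * h ≤ B := one_add_mul_le_pow (by linarith) k
  have hkB : 1 + (k : ℝ) ≤ (1 + 1 / h) * B := by
    calc 1 + (k : ℝ) ≤ 1 + k * h + 1 / h + k := by
          have : 0 ≤ k * h + 1 / h := by positivity
          linarith
      _ = (1 + 1 / h) * (1 + k * h) := by
          field_simp
          ring
      _ ≤ _ := by gcongr
  have h2 : (2 : ℝ) ≤ Real.exp 1 := by linarith [Real.exp_one_gt_d9]
  have e1 : (2 : ℝ) ^ N ≤ Real.exp (β * B) := by
    calc (2 : ℝ) ^ N ≤ Real.exp 1 ^ N := by gcongr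
      _ = Real.exp N := by rw [← Real.exp_nat_mul, mul_one]
      _ ≤ _ := Real.exp_le_exp.2 hN
  have e2 : Real.exp (-(k : ℝ)) ≤ (1 / 2) ^ k := by
    rw [Real.exp_neg, ← mul_one (k : ℝ), Real.exp_nat_mul, one_div, inv_pow]
    gcongr
  have hB0 : 0 < B := by positivity
  -- The part `β / 4` beats the count `2 ^ N` because `w ≥ 2`; the part `(1 + 1 / h) / 2` leaves `w
  -- * (1 + k) ≥ w + k`.
  calc _ ≤ Real.exp (β * B) * Real.exp (-(2 * ((β / 4 + (1 + 1 / h) / 2) * w * B))) := by gcongr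
    _ = Real.exp (β * B - β * B * w / 2 - w * ((1 + 1 / h) * B)) := by
        rw [← Real.exp_add]
        congr 1
        ring
    _ ≤ Real.exp (-w + -k) := by
        refine Real.exp_le_exp.2 ?_
        have f1 : w * (1 + k) ≤ w * ((1 + 1 / h) * B) := by gcongr
        have f2 : (k : ℝ) ≤ w * k := le_mul_of_one_le_left (by positivity) (by linarith)
        have f3 : β * B * 2 ≤ β * B * w := by gcongr
        linarith
    _ ≤ _ := by
        rw [Real.exp_add]
        gcongr

/-! ### The concentration inequality. -/

lemma empiricalMeasure_compl_eq_zero {E : Type*} [MeasurableSpace E] {n : ℕ} {x : Fin n → E}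
    {T : Set E} (hT : MeasurableSet T) (h : ∀ i, x i ∈ T) : empiricalMeasure x Tᶜ = 0 := by
  simp [empiricalMeasure, Measure.dirac_apply' _ hT.compl, h]

lemma edist_rpow_le_ofReal {E : Type*} [MetricSpace E] {p r : ℝ} (hp : 0 ≤ p) {x y : E}
    (h : dist x y ≤ r) : edist x y ^ p ≤ ENNReal.ofReal (r ^ p) := by
  rw [edist_dist, ENNReal.ofReal_rpow_of_nonneg dist_nonneg hp]
  exact ENNReal.ofReal_le_ofReal (Real.rpow_le_rpow dist_nonneg h hp)

/-- A single cell with `K = 0` suffices. This makes the event null when `x > Δ ^ p`. -/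
lemma wassersteinPow_le_diam_rpow {E : Type*} [MetricSpace E] [MeasurableSpace E] {p : ℝ}
    (hp : 0 ≤ p) {T : Set E} (hT : Bornology.IsBounded T) (μ ν : Measure E)
    [IsProbabilityMeasure μ] [IsProbabilityMeasure ν] (hμ : μ Tᶜ = 0) (hν : ν Tᶜ = 0) :
    wassersteinPow p μ ν ≤ ENNReal.ofReal (Metric.diam T ^ p) := by
  have hd : ∀ x ∈ T, ∀ y ∈ T, edist x y ^ p ≤ ENNReal.ofReal (Metric.diam T ^ p) :=
    fun x hx y hy => edist_rpow_le_ofReal hp (Metric.dist_le_diam_of_mem hT hx hy)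
  simpa using wassersteinPow_le_of_cells (ι := Unit) (p := p)
    (fun _ => ENNReal.ofReal (Metric.diam T ^ p)) (fun _ => {()}) (fun _ _ => ()) hd 0 (fun _ _ => measurable_const) (by simp)
    (fun _ _ x hx y hy _ => hd x hx y hy) (by simp) μ ν hμ hν

/-- The concentration inequality, with all scales expressed relatively to the diameter. -/
theorem measureReal_lt_wassersteinPow_le {p α β : ℝ} (hp : 1 ≤ p) (hα : 0 < α) (hβ : 0 < β) :
    ∃ C : ℝ, 0 < C ∧
      ∀ (E : Type*) [MetricSpace E] [MeasurableSpace E] [BorelSpace E]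
        (Ω : Type*) [MeasurableSpace Ω] (P : Measure Ω) [IsProbabilityMeasure P]
        (μ : Measure E) [IsProbabilityMeasure μ] (S : Set E) (n : ℕ) (X : Fin n → Ω → E) (z : ℝ),
        μ (closure S)ᶜ = 0 → IsFiniteDimensionalType S α β → 0 < Metric.diam S →
        0 < n → (∀ i, Measurable (X i)) → iIndepFun X P → (∀ i, P.map (X i) = μ) →
        (∀ᵐ ω ∂P, ∀ i, X i ω ∈ closure S) → 0 < z → z ≤ 1 →
        P.real {ω | ENNReal.ofReal (z * Metric.diam S ^ p) <
            wassersteinPow p μ (empiricalMeasure fun i => X i ω)} ≤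
          Real.exp 2 * Real.exp (-(n * concentrationRate p α C z)) := by
  have hp0 : 0 < p := by linarith
  set h : ℝ := (2 : ℝ) ^ α - 1 with hh
  have h0 : 0 < h := sub_pos.2 (Real.one_lt_rpow one_lt_two hα)
  set M : ℝ := β / 4 + (1 + 1 / h) / 2 with hM
  have hM0 : 0 < M := by positivity
  set a : ℝ := (2 : ℝ) ^ p with ha
  set b : ℝ := (2 : ℝ) ^ (α / 2) with hb
  have ha0 : 0 < a := by positivity
  have hb0 : 0 < b := by positivity
  have hb2 : b ^ 2 = 1 + h := by
    rw [hb, hh, ← Real.rpow_mul_natCast two_pos.le]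
    simp
  -- In `Q`, the `2` reserves half of `z` for the finest scale, `4 ^ p` comes from the cell
  -- diameters, and `√M * b` from the threshold at level `k + 1`.
  obtain ⟨C, hC, hscale⟩ := exists_scale_sum_le (Q := 2 * 4 ^ p * (√M * b)) hp hα (by positivity)
  refine ⟨C, hC, ?_⟩
  intro E _ _ _ Ω _ P _ μ _ S n X z hμ hS hΔ hn hX hind hlaw hXS hz hz1
  obtain ⟨K, v, hv0, hv, hK, hsum⟩ := hscale z hz hz1
  rw [← hv]
  -- If `n * v ^ 2 < 2` the right side exceeds `1`; otherwise `w = n * v ^ 2` is admissible in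
  -- `two_pow_mul_exp_le`.
  rcases lt_or_ge ((n : ℝ) * v ^ 2) 2 with hw | hw
  · refine measureReal_le_one.trans ?_
    rw [← Real.exp_add]
    exact Real.one_le_exp (by linarith)
  obtain ⟨g, s, hcard, hg, hgs, hgd, hnest⟩ := exists_nested_cells hS hΔ K
  set Δ := Metric.diam S with hΔdef
  -- Since `b ^ 2 = 2 ^ α`, the Hoeffding exponent `2 * n * y k ^ 2` grows like the bound on the
  -- number of cells.
  set y : ℕ → ℝ := fun k => √M * v * b ^ k with hy
  have hy0 : ∀ k, 0 ≤ y k := fun k => by positivity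
  -- Points of one cell lie within `2 * (Δ / 2 ^ k)` of a common centre, hence the `4`.
  have hD : ∀ k : ℕ, (4 * (Δ / 2 ^ k)) ^ p = 4 ^ p * Δ ^ p / a ^ k := by
    intro k
    rw [Real.mul_rpow (by norm_num) (by positivity), Real.div_rpow hΔ.le (by positivity), ha,
      ← Real.rpow_mul_natCast two_pos.le, ← Real.rpow_natCast_mul two_pos.le, mul_comm p,
      mul_div_assoc]
  have htotal : (4 * (Δ / 2 ^ K)) ^ p +
      ∑ k ∈ Finset.range K, (4 * (Δ / 2 ^ k)) ^ p * y (k + 1) ≤ z * Δ ^ p := by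
    simp_rw [hD]
    have e1 : 4 ^ p / a ^ K ≤ z / 2 := by
      rw [div_le_iff₀ hz] at hK
      rw [div_le_iff₀ (by positivity)]
      linarith
    have e2 : ∑ k ∈ Finset.range K, 4 ^ p * Δ ^ p / a ^ k * y (k + 1) =
        Δ ^ p * ((2 * 4 ^ p * (√M * b) * v * ∑ k ∈ Finset.range K, (b / a) ^ k) / 2) := by
      rw [Finset.mul_sum, Finset.sum_div, Finset.mul_sum]
      refine Finset.sum_congr rfl fun k _ => ?_
      rw [hy, div_pow]
      field_simp
      ring
    rw [e2]
    calc _ = Δ ^ p * (4 ^ p / a ^ K) + _ := by rw [mul_comm (4 ^ p) (Δ ^ p), mul_div_assoc]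
      _ ≤ Δ ^ p * (z / 2) + Δ ^ p * (z / 2) := by gcongr
      _ = z * Δ ^ p := by ring
  have hbdd : Bornology.IsBounded (closure S) := hS.1.closure
  have hsub : ∀ᵐ ω ∂P, ENNReal.ofReal (z * Δ ^ p) <
      wassersteinPow p μ (empiricalMeasure fun i => X i ω) →
      ω ∈ ⋃ k ∈ Finset.range K, {ω | ENNReal.ofReal (y (k + 1)) <
        cellExcess (s (k + 1)) (g (k + 1)) μ (empiricalMeasure fun i => X i ω)} := by
    filter_upwards [hXS] with ω hω hlt
    have := isProbabilityMeasure_empiricalMeasure hn fun i => X i ω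
    by_contra hno
    simp only [Set.mem_iUnion, not_exists, Set.mem_ofPred_eq, not_lt] at hno
    refine absurd hlt (not_lt.2 ?_)
    refine (wassersteinPow_le_of_cells (T := closure S)
      (fun k : ℕ => ENNReal.ofReal ((4 * (Δ / 2 ^ k)) ^ p)) s g ?_ K hg hgs ?_ hnest μ _ hμ
      (empiricalMeasure_compl_eq_zero isClosed_closure.measurableSet hω)).trans ?_
    · intro x hx x' hx'
      refine edist_rpow_le_ofReal hp0.le ?_
      have := Metric.dist_le_diam_of_mem hbdd hx hx'
      rw [Metric.diam_closure] at this
      simp only [pow_zero, div_one]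
      linarith
    · intro k hk x hx x' hx' hxx
      refine edist_rpow_le_ofReal hp0.le ?_
      have f1 := hgd k hk x hx
      have f2 := hgd k hk x' hx'
      have f3 := dist_triangle_right x x' (g k x)
      rw [← hxx] at f2
      linarith
    · calc _ ≤ ENNReal.ofReal ((4 * (Δ / 2 ^ K)) ^ p) + ∑ k ∈ Finset.range K,
            ENNReal.ofReal ((4 * (Δ / 2 ^ k)) ^ p) * ENNReal.ofReal (y (k + 1)) := by
            gcongr with k hk
            exact hno k hk
        _ = ENNReal.ofReal ((4 * (Δ / 2 ^ K)) ^ p +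
            ∑ k ∈ Finset.range K, (4 * (Δ / 2 ^ k)) ^ p * y (k + 1)) := by
            rw [ENNReal.ofReal_add (by positivity)
              (Finset.sum_nonneg fun k _ => mul_nonneg (by positivity) (hy0 _)),
              ENNReal.ofReal_sum_of_nonneg fun k _ => mul_nonneg (by positivity) (hy0 _)]
            congr 1
            exact Finset.sum_congr rfl fun k _ => (ENNReal.ofReal_mul (by positivity)).symm
        _ ≤ _ := ENNReal.ofReal_le_ofReal htotal
  have hterm : ∀ k ≤ K, P.real {ω | ENNReal.ofReal (y k) <
      cellExcess (s k) (g k) μ (empiricalMeasure fun i => X i ω)} ≤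
      Real.exp (-(n * v ^ 2)) * (1 / 2) ^ k := by
    intro k hk
    refine ((measureReal_lt_cellExcess_le hn hX hind hlaw (s k) (hg k hk) (hy0 k)).trans
      (le_trans (le_of_eq ?_) (two_pow_mul_exp_le hβ h0 hw ((hcard k).trans (le_of_eq ?_)))))
    · rw [← hM, ← hb2, hy]
      simp only [mul_pow, Real.sq_sqrt hM0.le]
      congr 3
      ring
    · rw [hh, add_sub_cancel]
  have hgeom : ∑ k ∈ Finset.range K, (1 / 2 : ℝ) ^ (k + 1) ≤ 1 := by
    have := sum_geometric_two_le K
    simp_rw [pow_succ, ← Finset.sum_mul]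
    linarith
  calc _ ≤ P.real (⋃ k ∈ Finset.range K, {ω | ENNReal.ofReal (y (k + 1)) <
        cellExcess (s (k + 1)) (g (k + 1)) μ (empiricalMeasure fun i => X i ω)}) :=
        ENNReal.toReal_mono (measure_ne_top _ _) (measure_mono_ae hsub)
    _ ≤ ∑ k ∈ Finset.range K, P.real {ω | ENNReal.ofReal (y (k + 1)) <
        cellExcess (s (k + 1)) (g (k + 1)) μ (empiricalMeasure fun i => X i ω)} :=
        measureReal_biUnion_finset_le _ _
    _ ≤ ∑ k ∈ Finset.range K, Real.exp (-(n * v ^ 2)) * (1 / 2) ^ (k + 1) :=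
        Finset.sum_le_sum fun k hk => hterm (k + 1) (Finset.mem_range.1 hk)
    _ ≤ Real.exp (-(n * v ^ 2)) * 1 := by
        rw [← Finset.mul_sum]
        gcongr
    _ ≤ _ := by
        rw [mul_comm]
        gcongr
        exact Real.one_le_exp two_pos.le

theorem mainTheorem5 (p α β : ℝ) (hp : 1 ≤ p) (hα : 0 < α) (hβ : 0 < β) :
    ∃ C : ℝ, 0 < C ∧
      ∀ (E : Type*) [MetricSpace E] [PolishSpace E] [MeasurableSpace E] [BorelSpace E]
        (Ω : Type*) [MeasurableSpace Ω] (P : Measure Ω) [IsProbabilityMeasure P]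
        (μ : Measure E) [IsProbabilityMeasure μ] (S : Set E) (n : ℕ) (X : Fin n → Ω → E) (x : ℝ),
        μ S = 1 → IsFiniteDimensionalType S α β →
        0 < n → (∀ i, Measurable (X i)) → iIndepFun X P → (∀ i, P.map (X i) = μ) →
        0 < x →
        P.real {ω | ENNReal.ofReal x < wassersteinPow p μ (empiricalMeasure fun i => X i ω)} ≤
          Real.exp 2 * (if x ≤ Metric.diam S ^ p then 1 else 0) *
            (if α < 2 * p then
              Real.exp (-(n * (x / (C * Metric.diam S ^ p)) ^ 2))
            else if α = 2 * p then
              Real.exp (-(n * (x / (C * Metric.diam S ^ p *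
                Real.log (Real.exp 1 + C * Metric.diam S ^ p / x))) ^ 2))
            else
              Real.exp (-(n * (x / (C * Metric.diam S ^ p)) ^ (α / p)))) := by
  obtain ⟨C, hC, H⟩ := measureReal_lt_wassersteinPow_le hp hα hβ
  refine ⟨C, hC, ?_⟩
  intro E _ _ _ _ Ω _ P _ μ _ S n X x hμS hS hn hX hind hlaw hx
  have hp0 : 0 < p := by linarith
  -- `S` need not be measurable; its closure is, with the same diameter.
  have hT : MeasurableSet (closure S) := isClosed_closure.measurableSet
  have hμ : μ (closure S)ᶜ = 0 := by
    rw [prob_compl_eq_zero_iff hT]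
    exact le_antisymm prob_le_one (hμS ▸ measure_mono subset_closure)
  have hXS : ∀ᵐ ω ∂P, ∀ i, X i ω ∈ closure S := by
    refine ae_all_iff.2 fun i => ae_of_ae_map (p := fun e => e ∈ closure S) (hX i).aemeasurable ?_
    rw [hlaw i]
    exact hμ
  by_cases hxΔ : x ≤ Metric.diam S ^ p
  · have hΔ : 0 < Metric.diam S := by
      refine lt_of_le_of_ne Metric.diam_nonneg fun h0 => ?_
      rw [← h0, Real.zero_rpow hp0.ne'] at hxΔ
      linarith
    have hΔp : 0 < Metric.diam S ^ p := Real.rpow_pos_of_pos hΔ p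
    have key := H E Ω P μ S n X (x / Metric.diam S ^ p) hμ hS hΔ hn hX hind hlaw hXS
      (by positivity) ((div_le_one hΔp).2 hxΔ)
    rw [div_mul_cancel₀ _ hΔp.ne'] at key
    refine key.trans (le_of_eq ?_)
    have e1 : x / Metric.diam S ^ p / C = x / (C * Metric.diam S ^ p) := by
      rw [div_div, mul_comm C]
    have e2 : C / (x / Metric.diam S ^ p) = C * Metric.diam S ^ p / x := by
      rw [div_div_eq_mul_div]
    have e3 : ∀ L, x / Metric.diam S ^ p / (C * L) = x / (C * Metric.diam S ^ p * L) := by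
      intro L
      rw [div_div, ← mul_assoc, mul_comm C]
    rw [if_pos hxΔ, mul_one, concentrationRate, e1, e2, e3]
    split_ifs <;> rfl
  · rw [if_neg hxΔ, mul_zero, zero_mul]
    refine le_of_eq ?_
    rw [measureReal_eq_zero_iff (measure_ne_top _ _)]
    refine measure_mono_null (t := {ω | ¬ ∀ i, X i ω ∈ closure S}) ?_ hXS
    intro ω hω hin
    have := isProbabilityMeasure_empiricalMeasure hn fun i => X i ω
    have hW := wassersteinPow_le_diam_rpow hp0.le hS.1.closure μ _ hμ
      (empiricalMeasure_compl_eq_zero hT hin)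
    rw [Metric.diam_closure] at hW
    exact absurd (hW.trans (ENNReal.ofReal_le_ofReal (not_le.1 hxΔ).le)) (not_le.2 hω)
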